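/- Let $\alpha,\beta,\gamma,\delta,t,q\in\mathbb C$ and $\epsilon\in\mathbb Z_{\le 0}$ with $\gamma+\delta+\epsilon=\alpha+\beta+1$ and $t\ne 0,1$, and consider Heun's differential equation $$\frac{d^2y}{dz^2}+\Big(\frac{\gamma}{z}+\frac{\delta}{z-1}+\frac{\epsilon}{z-t}\Big)\frac{dy}{dz}+\frac{\alpha\beta z-q}{z(z-1)(z-t)}\,y=0 .\qquad (*)$$ Assume that $\alpha,\ \beta,\ \beta-\gamma,\ \beta-\delta\notin\mathbb Z$ and that the singularity $z=t$ of $(*)$ is apparent, i.e. that there is a basis of local solutions near $t$ without a logarithmic term, of the form $f(z)=\sum_{j\ge0}c_j(z-t)^j$ with $c_0\ne0$ and $(z-t)^{1-\epsilon}\sum_{j\ge0}\tilde c_j(z-t)^j$ with $\tilde c_0\neq0$ (convergent power series). Then every solution of $(*)$ is a finite linear combination of Gauss hypergeometric functions. Precisely, let $F(a,b;c;z)$ (where $c\notin\mathbb Z_{\le0}$) denote the holomorphic function on $\mathbb C\setminus[1,\infty)$ that continues the hypergeometric series $\sum_{n\ge 0}\frac{(a)_n(b)_n}{(c)_n\,n!}z^n$,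 and let $\Omega=\mathbb C\setminus\big((-\infty,0]\cup[1,\infty)\big)$. There are finitely many functions $\varphi_1,\dots,\varphi_N$ on $\Omega$, each of one of the forms $$F(a,b;c;z),\quad z^{c-1}F(a,b;c;z),\quad F(a,b;c;1-z),\quad (1-z)^{c-1}F(a,b;c;1-z)$$ (with principal branches, and with $a,b,c\in\mathbb C$, $c\notin\mathbb Z_{\le0}$, depending on the function), such that for every connected open set $U\subseteq\Omega\setminus\{t\}$ and every holomorphic solution $y$ of $(*)$ on $U$ there are constants $C_1,\dots,C_N\in\mathbb C$ with $y(z)=\sum_{i=1}^N C_i\,\varphi_i(z)$ for all $z\in U$. -/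

import Mathlib

/-- The left-hand side of Heun's differential equation, at the point `z`:
`y'' + (γ/z + δ/(z-1) + ε/(z-t)) y' + (α β z - q)/(z (z-1) (z-t)) y`. -/
noncomputable def heunLHS (α β γ δ ε t q : ℂ) (y : ℂ → ℂ) (z : ℂ) : ℂ :=
  deriv (deriv y) z + (γ / z + δ / (z - 1) + ε / (z - t)) * deriv y z
    + (α * β * z - q) / (z * (z - 1) * (z - t)) * y z

/-- The function `y` is holomorphic on `U` and solves Heun's equation there
(`U` is meant to be an open set that contains none of `0`, `1`, `t`). -/
def IsHeunSolutionOn (α β γ δ ε t q : ℂ) (U : Set ℂ) (y : ℂ → ℂ) : Prop :=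
  DifferentiableOn ℂ y U ∧ ∀ z ∈ U, heunLHS α β γ δ ε t q y z = 0

/-- For an integer `ε ≤ 0`, the singularity `z = t` of Heun's equation, whose exponents are `0` and
`1 - ε`, is apparent: there is a basis of local solutions without a logarithmic term, that is
`f z = ∑ c j (z-t)^j` with `c 0 ≠ 0`, and `(z-t)^(1-ε) * g z` with `g z = ∑ c' j (z-t)^j` and
`c' 0 ≠ 0`, where both power series converge near `t`. -/
def HeunApparentAt (α β γ δ : ℂ) (ε : ℤ) (t q : ℂ) : Prop :=
  ∃ f g : ℂ → ℂ,
    AnalyticAt ℂ f t ∧ f t ≠ 0 ∧ AnalyticAt ℂ g t ∧ g t ≠ 0 ∧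
    (∀ᶠ z in nhdsWithin t {t}ᶜ, heunLHS α β γ δ ε t q f z = 0) ∧
    (∀ᶠ z in nhdsWithin t {t}ᶜ,
      heunLHS α β γ δ ε t q (fun w => (w - t) ^ (1 - ε) * g w) z = 0)

/-- The plane without the cut `[1, ∞)`. -/
def gaussDomain : Set ℂ := {z | 1 - z ∈ Complex.slitPlane}

/-- The plane without the two cuts `(-∞, 0]` and `[1, ∞)`. -/
def doublySlitPlane : Set ℂ := {z | z ∈ Complex.slitPlane ∧ 1 - z ∈ Complex.slitPlane}

/-- `F` is (on the plane cut along `[1, ∞)`) the Gauss hypergeometric function `F(a, b; c; z)`: the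
parameter `c` is not a non-positive integer, `F` is holomorphic on the cut plane, and in the unit
disc it is the sum of the hypergeometric series. -/
def IsGaussHypergeometric (a b c : ℂ) (F : ℂ → ℂ) : Prop :=
  (∀ n : ℕ, c ≠ -(n : ℂ)) ∧ DifferentiableOn ℂ F gaussDomain ∧
    ∀ z : ℂ, ‖z‖ < 1 → F z = ordinaryHypergeometric a b c z

/-- On the doubly slit plane, `φ` is one of the hypergeometric functions
`F(a, b; c; z)`, `z^(c-1) F(a, b; c; z)`, `F(a, b; c; 1-z)`, `(1-z)^(c-1) F(a, b; c; 1-z)`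
(principal branches): these are the standard solutions, at the points `0` and `1`, of the
hypergeometric differential equations. -/
def IsHypergeometricSolution (φ : ℂ → ℂ) : Prop :=
  ∃ (a b c : ℂ) (F : ℂ → ℂ), IsGaussHypergeometric a b c F ∧
    ((∀ z ∈ doublySlitPlane, φ z = F z) ∨
     (∀ z ∈ doublySlitPlane, φ z = z ^ (c - 1) * F z) ∨
     (∀ z ∈ doublySlitPlane, φ z = F (1 - z)) ∨
     (∀ z ∈ doublySlitPlane, φ z = (1 - z) ^ (c - 1) * F (1 - z)))

/-! Write `ε = -M`. The nonlogarithmic solution with nonzero value at `t` makes Heun's operator,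
acting on `M`-jets at `t`, a singular square matrix, so some nonzero functional `Λ` on jets kills
its image (`exists_functional_of_triCoeff_eq_zero`). On monomials, `Λ (z ^ n) = t ^ n * P n` with
`P` a nonzero polynomial. Applying `Λ` to Heun's operator on `z ^ n` gives a three-term recurrence
for `P`, adjoint to the one for power series solutions at `0` (`exists_polynomial_of_heun`).

Let `g` satisfy `(n + 1) (n + γ) g (n + 1) = (n + α) (n + β) g n`. The adjoint recurrence says
exactly that `P n * g n` are the coefficients of a Heun solution at `0`. Expanding `P` in rising
factorials turns this series into a finite sum of contiguous hypergeometric functions, holomorphic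
off `[1, ∞)` (`exists_heun_solution_of_apparent`).

The reflection `z ↦ 1 - z` gives a second solution, holomorphic off `(-∞, 0]`. A linear relation
between the two would produce an entire solution, but the series at `0` and its mirror image have
finite radius of convergence because `α` and `β` are not integers (`not_entire_of_ratio`). So the
two solutions form a basis, and comparing Cauchy data at one point finishes the proof. -/

open Filter Topology Polynomial

/-! ### Taylor coefficients and three-term recurrences -/

section

open FormalMultilinearSeries

/-- `a` is the sequence of Taylor coefficients of the analytic function `f` at `c`. -/
def HasTaylor (f : ℂ → ℂ) (c : ℂ) (a : ℕ → ℂ) : Prop :=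
  HasFPowerSeriesAt f (ofScalars ℂ a) c

namespace HasTaylor

variable {f g : ℂ → ℂ} {c : ℂ} {a b : ℕ → ℂ}

theorem iff_hasSum : HasTaylor f c a ↔ ∀ᶠ z in 𝓝 0, HasSum (fun n => z ^ n * a n) (f (c + z)) := by
  rw [HasTaylor, hasFPowerSeriesAt_iff]
  simp [coeff_ofScalars]

theorem analyticAt (h : HasTaylor f c a) : AnalyticAt ℂ f c := ⟨_, h⟩

theorem unique (h : HasTaylor f c a) (h' : HasTaylor f c b) : a = b :=
  (ofScalars_series_injective ℂ ℂ) (HasFPowerSeriesAt.eq_formalMultilinearSeries h h')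

theorem congr (h : HasTaylor f c a) (hfg : f =ᶠ[𝓝 c] g) : HasTaylor g c a :=
  HasFPowerSeriesAt.congr h hfg

theorem of_analyticAt (h : AnalyticAt ℂ f c) :
    HasTaylor f c (fun n => iteratedDeriv n f c / n.factorial) :=
  h.hasFPowerSeriesAt

theorem zero : HasTaylor (fun _ => 0) c 0 := by
  rw [iff_hasSum]
  exact Eventually.of_forall fun z => by simp

theorem add (h : HasTaylor f c a) (h' : HasTaylor g c b) :
    HasTaylor (fun z => f z + g z) c (fun n => a n + b n) := by
  rw [iff_hasSum] at *
  filter_upwards [h, h'] with z h1 h2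
  simpa [mul_add] using h1.add h2

theorem const_mul (k : ℂ) (h : HasTaylor f c a) :
    HasTaylor (fun z => k * f z) c (fun n => k * a n) := by
  rw [iff_hasSum] at *
  filter_upwards [h] with z h1
  simpa [mul_left_comm] using h1.mul_left k

theorem apply_center (h : HasTaylor f c a) : f c = a 0 := by
  have := h.unique (of_analyticAt h.analyticAt)
  rw [this]; simp

theorem deriv (h : HasTaylor f c a) :
    HasTaylor (deriv f) c (fun n => (n + 1) * a (n + 1)) := by
  have h1 := h.unique (of_analyticAt h.analyticAt)
  have h2 := of_analyticAt h.analyticAt.deriv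
  convert h2 using 2 with n
  simp only [h1, ← iteratedDeriv_succ', Nat.factorial_succ]
  have : (n.factorial : ℂ) ≠ 0 := by exact_mod_cast n.factorial_ne_zero
  have : (n + 1 : ℂ) ≠ 0 := by exact_mod_cast n.succ_ne_zero
  push_cast
  field_simp

/-- The Taylor coefficients of `z - c` times a function. -/
def shift (a : ℕ → ℂ) : ℕ → ℂ
  | 0 => 0
  | n + 1 => a n

theorem sub_mul (h : HasTaylor f c a) : HasTaylor (fun z => (z - c) * f z) c (shift a) := by
  rw [iff_hasSum] at *
  filter_upwards [h] with z h1
  rw [← hasSum_nat_add_iff' 1]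
  have := h1.mul_left z
  simpa [shift, pow_succ, mul_assoc, mul_left_comm] using this

theorem eventually_zero_iff (h : HasTaylor f c a) : (∀ᶠ z in 𝓝 c, f z = 0) ↔ ∀ n, a n = 0 := by
  constructor
  · intro h0 n
    exact congrFun ((h.congr h0).unique zero) n
  · intro h0
    rw [show a = 0 from funext h0] at h
    rw [HasTaylor, ofScalars_series_eq_zero_of_scalar_zero] at h
    exact h.eventually_eq_zero

theorem hasSum_of_differentiableOn {r : ℝ} (h : HasTaylor f c a)
    (hf : DifferentiableOn ℂ f (Metric.ball c r)) {z : ℂ} (hz : z ∈ Metric.ball c r) :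
    HasSum (fun n => (z - c) ^ n * a n) (f z) := by
  have := Complex.hasSum_taylorSeries_on_ball hf hz
  rw [h.unique (of_analyticAt h.analyticAt)]
  refine this.congr_fun fun n => ?_
  simp only [smul_eq_mul]
  ring

theorem exists_of_bound (h : ∀ ρ : NNReal, ρ < 1 → ∃ C : ℝ, ∀ n, ‖a n‖ * (ρ : ℝ) ^ n ≤ C) :
    ∃ G : ℂ → ℂ, DifferentiableOn ℂ G (Metric.ball c 1) ∧ HasTaylor G c a := by
  have hr : 1 ≤ (ofScalars ℂ a).radius := by
    refine ENNReal.le_of_forall_nnreal_lt fun ρ hρ => ?_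
    obtain ⟨C, hC⟩ := h ρ (by exact_mod_cast hρ)
    exact le_radius_of_bound _ C fun n => by rw [ofScalars_norm]; exact hC n
  have hG := (ofScalars ℂ a).hasFPowerSeriesOnBall (lt_of_lt_of_le one_pos hr)
  have hG' := (hG.comp_sub c).mono one_pos hr
  rw [zero_add] at hG'
  refine ⟨_, ?_, hG'.hasFPowerSeriesAt⟩
  have := hG'.differentiableOn
  rwa [← ENNReal.ofReal_one, Metric.eball_ofReal] at this

end HasTaylor

end

/-- Since `‖u n‖ ρ + ‖v n‖ ρ ^ 2` tends to `ρ ^ 2 < 1`, from some index on each weighted term is at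
most the larger of its two predecessors. The sum of the initial terms is then a bound for all. -/
theorem bound_of_recurrence {k u v : ℕ → ℂ} (hu : Tendsto u atTop (𝓝 0))
    (hv : Tendsto v atTop (𝓝 1)) (h : ∀ n, k (n + 2) = u n * k (n + 1) + v n * k n)
    {ρ : ℝ} (h0 : 0 ≤ ρ) (h1 : ρ < 1) : ∃ C : ℝ, ∀ n, ‖k n‖ * ρ ^ n ≤ C := by
  have hlim : Tendsto (fun n => ‖u n‖ * ρ + ‖v n‖ * ρ ^ 2) atTop (𝓝 (‖(0 : ℂ)‖ * ρ +
    ‖(1 : ℂ)‖ * ρ ^ 2)) := (hu.norm.mul_const _).add (hv.norm.mul_const _)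
  have hlt : ‖(0 : ℂ)‖ * ρ + ‖(1 : ℂ)‖ * ρ ^ 2 < 1 := by
    simp only [norm_zero, norm_one]
    nlinarith
  obtain ⟨N, hN⟩ := eventually_atTop.1 (hlim.eventually (gt_mem_nhds hlt))
  have hpos : ∀ n, 0 ≤ ‖k n‖ * ρ ^ n := fun n => by positivity
  refine ⟨∑ i ∈ Finset.range (N + 2), ‖k i‖ * ρ ^ i, fun n => ?_⟩
  have hC := Finset.sum_nonneg (s := Finset.range (N + 2)) fun i _ => hpos i
  induction n using Nat.strong_induction_on with
  | _ n ih =>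
    by_cases hn : n < N + 2
    · exact Finset.single_le_sum (f := fun i => ‖k i‖ * ρ ^ i) (fun i _ => hpos i)
        (Finset.mem_range.2 hn)
    · obtain ⟨m, rfl⟩ : ∃ m, n = m + 2 := ⟨n - 2, by omega⟩
      have e1 := ih (m + 1) (by omega)
      have e2 := ih m (by omega)
      have e3 := hN m (by omega)
      set C := ∑ i ∈ Finset.range (N + 2), ‖k i‖ * ρ ^ i
      calc ‖k (m + 2)‖ * ρ ^ (m + 2)
          ≤ (‖u m‖ * ‖k (m + 1)‖ + ‖v m‖ * ‖k m‖) * ρ ^ (m + 2) := by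
            gcongr
            rw [h, ← norm_mul, ← norm_mul]
            exact norm_add_le _ _
        _ = ‖u m‖ * ρ * (‖k (m + 1)‖ * ρ ^ (m + 1)) + ‖v m‖ * ρ ^ 2 * (‖k m‖ * ρ ^ m) := by ring
        _ ≤ ‖u m‖ * ρ * C + ‖v m‖ * ρ ^ 2 * C := by gcongr
        _ = (‖u m‖ * ρ + ‖v m‖ * ρ ^ 2) * C := by ring
        _ ≤ 1 * C := by gcongr
        _ = C := one_mul C

/-- A second order differential operator whose action on power series in `z - c` is given by
a three term recurrence. -/
noncomputable def triOp (p₃ p₂ p₁ r₂ r₁ r₀ s₁ s₀ c : ℂ) (f : ℂ → ℂ) (z : ℂ) : ℂ :=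
  (p₃ * (z - c) ^ 3 + p₂ * (z - c) ^ 2 + p₁ * (z - c)) * deriv (deriv f) z
    + (r₂ * (z - c) ^ 2 + r₁ * (z - c) + r₀) * deriv f z + (s₁ * (z - c) + s₀) * f z

/-- The three term expression in the coefficients attached to `triOp`. -/
def triCoeff (p₃ p₂ p₁ r₂ r₁ r₀ s₁ s₀ : ℂ) (a : ℕ → ℂ) : ℕ → ℂ
  | 0 => r₀ * a 1 + s₀ * a 0
  | n + 1 => (p₁ * (n + 1) + r₀) * (n + 2) * a (n + 2)
      + (p₂ * (n + 1) * n + r₁ * (n + 1) + s₀) * a (n + 1)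
      + (p₃ * n * (n - 1) + r₂ * n + s₁) * a n

theorem HasTaylor.triOp {f : ℂ → ℂ} {c : ℂ} {a : ℕ → ℂ} (h : HasTaylor f c a)
    (p₃ p₂ p₁ r₂ r₁ r₀ s₁ s₀ : ℂ) :
    HasTaylor (triOp p₃ p₂ p₁ r₂ r₁ r₀ s₁ s₀ c f) c (triCoeff p₃ p₂ p₁ r₂ r₁ r₀ s₁ s₀ a) := by
  have h1 := h.deriv
  have h2 := h1.deriv
  have e := ((((h2.sub_mul.sub_mul.sub_mul.const_mul p₃).add (h2.sub_mul.sub_mul.const_mul p₂)).add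
    (h2.sub_mul.const_mul p₁)).add (((h1.sub_mul.sub_mul.const_mul r₂).add
    (h1.sub_mul.const_mul r₁)).add (h1.const_mul r₀))).add
    ((h.sub_mul.const_mul s₁).add (h.const_mul s₀))
  convert e using 1
  · funext z
    simp only [_root_.triOp]
    ring
  · funext n
    rcases n with _ | _ | _ | n <;> simp [triCoeff, HasTaylor.shift] <;> ring

/-! ### Continuation of the hypergeometric series to the cut plane -/

theorem isOpen_gaussDomain : IsOpen gaussDomain :=
  Complex.isOpen_slitPlane.preimage (f := fun z : ℂ => 1 - z) (by fun_prop)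

theorem ball_subset_gaussDomain : Metric.ball (0 : ℂ) 1 ⊆ gaussDomain := fun z hz => by
  simp only [Metric.mem_ball, dist_zero_right] at hz
  refine Or.inl ?_
  have := (Complex.re_le_norm z).trans_lt hz
  simpa using this

theorem zero_mem_gaussDomain : (0 : ℂ) ∈ gaussDomain :=
  ball_subset_gaussDomain (by simp)

theorem add_natCast_ne_zero {c : ℂ} (hc : ∀ n : ℕ, c ≠ -(n : ℂ)) (n : ℕ) : c + n ≠ 0 :=
  fun h => hc n (eq_neg_of_add_eq_zero_left h)

theorem hypergeometricCoefficient_succ {c : ℂ} (hc : ∀ n : ℕ, c ≠ -(n : ℂ)) (a b : ℂ) (n : ℕ) :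
    (n + 1) * (c + n) * ordinaryHypergeometricCoefficient a b c (n + 1) =
      (a + n) * (b + n) * ordinaryHypergeometricCoefficient a b c n := by
  have h1 := add_natCast_ne_zero hc n
  have h2 : (n + 1 : ℂ) ≠ 0 := by exact_mod_cast n.succ_ne_zero
  simp only [ordinaryHypergeometricCoefficient, ascPochhammer_succ_eval, Nat.factorial_succ,
    Nat.cast_mul, Nat.cast_succ, mul_inv]
  field_simp

theorem hypergeometricCoefficient_ratio_tendsto (a b c : ℂ) :
    Tendsto (fun n : ℕ => (a + n) * (b + n) / ((n + 1) * (c + n))) atTop (𝓝 1) := by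
  have h1 := tendsto_add_mul_div_add_mul_atTop_nhds a 1 1 (one_ne_zero (α := ℂ))
  have h2 := tendsto_add_mul_div_add_mul_atTop_nhds b c 1 (one_ne_zero (α := ℂ))
  have := h1.mul h2
  simp only [one_mul, div_one] at this
  refine this.congr fun n => ?_
  rw [div_mul_div_comm, add_comm (1 : ℂ)]

theorem IsGaussHypergeometric.of_hasTaylor {a b c : ℂ} {F : ℂ → ℂ} (hc : ∀ n : ℕ, c ≠ -(n : ℂ))
    (hF : DifferentiableOn ℂ F gaussDomain)
    (h : HasTaylor F 0 (ordinaryHypergeometricCoefficient a b c)) :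
    IsGaussHypergeometric a b c F := by
  refine ⟨hc, hF, fun z hz => ?_⟩
  have := h.hasSum_of_differentiableOn (hF.mono ball_subset_gaussDomain) (z := z) (by simpa using hz)
  rw [← this.tsum_eq, ordinaryHypergeometric_eq_tsum]
  refine tsum_congr fun n => ?_
  simp [mul_comm]

theorem exists_hasTaylor_hypergeometric {c : ℂ} (hc : ∀ n : ℕ, c ≠ -(n : ℂ)) (a b : ℂ) :
    ∃ G : ℂ → ℂ, HasTaylor G 0 (ordinaryHypergeometricCoefficient a b c) := by
  have hr := hypergeometricCoefficient_ratio_tendsto a b c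
  set k := ordinaryHypergeometricCoefficient a b c with hk
  set v := fun n : ℕ => (a + n) * (b + n) / ((n + 1) * (c + n)) with hv
  have hs : ∀ n, k (n + 1) = v n * k n := fun n => by
    have h1 := add_natCast_ne_zero hc n
    have h2 : (n + 1 : ℂ) ≠ 0 := by exact_mod_cast n.succ_ne_zero
    have := hypergeometricCoefficient_succ hc a b n
    rw [← hk] at this
    rw [hv]
    field_simp
    linear_combination this
  -- The one-step recursion is applied twice, which fits the three-term bound with middle
  -- coefficient `0`.
  have hv2 : Tendsto (fun n => v (n + 1) * v n) atTop (𝓝 1) := by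
    simpa using (hr.comp (tendsto_add_atTop_nat 1)).mul hr
  obtain ⟨G, -, h⟩ := HasTaylor.exists_of_bound (a := k) (c := 0) fun ρ hρ =>
    bound_of_recurrence (u := fun _ => 0) tendsto_const_nhds hv2
      (fun n => by rw [hs, hs]; ring) ρ.2 hρ
  exact ⟨G, h⟩

theorem hypergeometric_triOp {a b c : ℂ} {G : ℂ → ℂ} (hc : ∀ n : ℕ, c ≠ -(n : ℂ))
    (h : HasTaylor G 0 (ordinaryHypergeometricCoefficient a b c)) :
    ∀ᶠ z in 𝓝 0, triOp 0 (-1) 1 0 (-(a + b + 1)) c 0 (-(a * b)) 0 G z = 0 := by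
  rw [(h.triOp 0 (-1) 1 0 (-(a + b + 1)) c 0 (-(a * b))).eventually_zero_iff]
  rintro (_ | n)
  · have := hypergeometricCoefficient_succ hc a b 0
    simp only [triCoeff]
    push_cast at this
    linear_combination this
  · have := hypergeometricCoefficient_succ hc a b (n + 1)
    simp only [triCoeff]
    push_cast at this
    linear_combination this

theorem hasDerivAt_one_add_cpow (s : ℂ) {w : ℂ} (hw : 1 + w ∈ Complex.slitPlane) :
    HasDerivAt (fun w : ℂ => (1 + w) ^ s) ((1 + w) ^ s * (s / (1 + w))) w := by
  have h0 : 1 + w ≠ 0 := Complex.slitPlane_ne_zero hw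
  have h1 : HasDerivAt (fun w : ℂ => 1 + w) 1 w := (hasDerivAt_id w).const_add 1
  refine (h1.cpow_const (c := s) hw).congr_deriv ?_
  rw [Complex.cpow_sub _ _ h0, Complex.cpow_one]
  ring

theorem hasDerivAt_quadratic {w : ℂ} (hw : 1 + w ≠ 0) :
    HasDerivAt (fun w : ℂ => 4 * w / (1 + w) ^ 2) (4 * (1 - w) / (1 + w) ^ 3) w := by
  have h1 : HasDerivAt (fun w : ℂ => 1 + w) 1 w := (hasDerivAt_id w).const_add 1
  refine (((hasDerivAt_id w).const_mul 4).div (h1.pow 2) (pow_ne_zero 2 hw)).congr_deriv ?_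
  simp only [id, Pi.pow_apply, Nat.cast_ofNat]
  field_simp
  ring

theorem hasDerivAt_quadratic_deriv {w : ℂ} (hw : 1 + w ≠ 0) :
    HasDerivAt (fun w : ℂ => 4 * (1 - w) / (1 + w) ^ 3) ((8 * w - 16) / (1 + w) ^ 4) w := by
  have h1 : HasDerivAt (fun w : ℂ => 1 + w) 1 w := (hasDerivAt_id w).const_add 1
  refine ((((hasDerivAt_id w).const_sub 1).const_mul 4).div (h1.pow 3)
    (pow_ne_zero 3 hw)).congr_deriv ?_
  simp only [id, Pi.pow_apply, Nat.cast_ofNat]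
  field_simp
  ring

/-- The hypergeometric equation after the change of variables `z = 4 w / (1 + w) ^ 2`, which maps
the unit disc onto the plane cut along `[1, ∞)`. -/
theorem quadratic_triOp {a b c : ℂ} {G : ℂ → ℂ} (hG : AnalyticAt ℂ G 0)
    (h : ∀ᶠ z in 𝓝 0, triOp 0 (-1) 1 0 (-(a + b + 1)) c 0 (-(a * b)) 0 G z = 0) :
    ∀ᶠ w in 𝓝 0, triOp 1 0 (-1) (2 + 4 * a - c) (4 * b - 2 * c) (-c) (2 * a * (2 * a + 1 - c))
      (4 * a * b - 2 * a * c) 0 (fun w => (1 + w) ^ (-2 * a) * G (4 * w / (1 + w) ^ 2)) w = 0 := by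
  have hφ : ContinuousAt (fun w : ℂ => 4 * w / (1 + w) ^ 2) 0 :=
    ContinuousAt.div (by fun_prop) (by fun_prop) (by simp)
  have hφ0 : Tendsto (fun w : ℂ => 4 * w / (1 + w) ^ 2) (𝓝 0) (𝓝 0) := by
    simpa [ContinuousAt] using hφ
  have hw : ∀ᶠ w : ℂ in 𝓝 0, 1 + w ∈ Complex.slitPlane :=
    ContinuousAt.eventually_mem (f := fun w : ℂ => 1 + w) (by fun_prop)
      (by simpa using Complex.isOpen_slitPlane.mem_nhds Complex.one_mem_slitPlane)
  have hG' := hG.eventually_analyticAt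
  have key : ∀ w : ℂ, 1 + w ∈ Complex.slitPlane → AnalyticAt ℂ G (4 * w / (1 + w) ^ 2) →
      HasDerivAt (fun w => (1 + w) ^ (-2 * a) * G (4 * w / (1 + w) ^ 2))
      ((1 + w) ^ (-2 * a) * (deriv G (4 * w / (1 + w) ^ 2) * (4 * (1 - w) / (1 + w) ^ 3)
        - 2 * a / (1 + w) * G (4 * w / (1 + w) ^ 2))) w := by
    intro w hw hg
    have hw0 := Complex.slitPlane_ne_zero hw
    refine ((hasDerivAt_one_add_cpow (-2 * a) hw).mul
      (hg.differentiableAt.hasDerivAt.comp w (hasDerivAt_quadratic hw0))).congr_deriv ?_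
    simp only [Function.comp]
    ring
  have hall := (hw.and (hφ0.eventually (hG'.and h))).eventually_nhds
  filter_upwards [hall] with w hall
  obtain ⟨hw, hg, hode⟩ := hall.self_of_nhds
  have hw0 := Complex.slitPlane_ne_zero hw
  have d1 : deriv (fun w => (1 + w) ^ (-2 * a) * G (4 * w / (1 + w) ^ 2)) =ᶠ[𝓝 w] fun w =>
      (1 + w) ^ (-2 * a) * (deriv G (4 * w / (1 + w) ^ 2) * (4 * (1 - w) / (1 + w) ^ 3)
        - 2 * a / (1 + w) * G (4 * w / (1 + w) ^ 2)) := by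
    filter_upwards [hall] with v hv
    exact (key v hv.1 hv.2.1).deriv
  have h1 : HasDerivAt (fun w : ℂ => 1 + w) 1 w := (hasDerivAt_id w).const_add 1
  have d2 := ((hasDerivAt_one_add_cpow (-2 * a) hw).mul
    (((hg.deriv.differentiableAt.hasDerivAt.comp w (hasDerivAt_quadratic hw0)).mul
      (hasDerivAt_quadratic_deriv hw0)).sub (((hasDerivAt_const w (2 * a)).div h1 hw0).mul
        (hg.differentiableAt.hasDerivAt.comp w (hasDerivAt_quadratic hw0))))).deriv
  simp only [triOp, d1.deriv_eq, d1.self_of_nhds]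
  erw [d2]
  simp only [Function.comp, triOp, sub_zero, Pi.mul_apply, Pi.sub_apply, Pi.div_apply] at hode ⊢
  -- With `G` and its derivatives as independent symbols, the new equation is an algebraic multiple
  -- of the old one.
  generalize (1 + w) ^ (-2 * a) = E
  generalize deriv (deriv G) (4 * w / (1 + w) ^ 2) = g2 at *
  generalize deriv G (4 * w / (1 + w) ^ 2) = g1 at *
  generalize G (4 * w / (1 + w) ^ 2) = g0 at *
  field_simp at hode ⊢
  apply mul_left_cancel₀ hw0
  linear_combination (-4 * (1 - w)) * E * hode

theorem quadratic_recurrence_limits (a b c : ℂ) :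
    Tendsto (fun n : ℕ => ((4 * b - 2 * c) * (n + 1) + (4 * a * b - 2 * a * c)) /
      ((c + 1 + n) * (2 + n))) atTop (𝓝 0) ∧
    Tendsto (fun n : ℕ => (2 * a + n) * (2 * a + 1 - c + n) / ((c + 1 + n) * (2 + n)))
      atTop (𝓝 1) := by
  constructor
  · have h1 := tendsto_add_mul_div_add_mul_atTop_nhds (4 * b - 2 * c + (4 * a * b - 2 * a * c))
      (c + 1) (4 * b - 2 * c) (one_ne_zero (α := ℂ))
    have h2 := tendsto_add_mul_div_add_mul_atTop_nhds 1 2 0 (one_ne_zero (α := ℂ))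
    have := h1.mul h2
    simp only [one_mul, div_one, zero_mul, add_zero, mul_zero] at this
    refine this.congr fun n => ?_
    rw [div_mul_div_comm]
    ring
  · have h1 := tendsto_add_mul_div_add_mul_atTop_nhds (2 * a) (c + 1) 1 (one_ne_zero (α := ℂ))
    have h2 := tendsto_add_mul_div_add_mul_atTop_nhds (2 * a + 1 - c) 2 1 (one_ne_zero (α := ℂ))
    have := h1.mul h2
    simp only [one_mul, div_one] at this
    refine this.congr fun n => ?_
    rw [div_mul_div_comm]

/-- The square root of `1 - z` on the plane cut along `[1, ∞)`. -/
noncomputable def slitSqrt (z : ℂ) : ℂ := Complex.exp (Complex.log (1 - z) / 2)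

theorem slitSqrt_sq {z : ℂ} (hz : z ∈ gaussDomain) : slitSqrt z ^ 2 = 1 - z := by
  rw [slitSqrt, ← Complex.exp_nat_mul]
  push_cast
  rw [mul_div_cancel₀ _ two_ne_zero, Complex.exp_log (Complex.slitPlane_ne_zero hz)]

theorem slitSqrt_re_pos {z : ℂ} (hz : z ∈ gaussDomain) : 0 < (slitSqrt z).re := by
  have h1 := Complex.mem_slitPlane_iff_arg.1 hz
  have h2 := Complex.neg_pi_lt_arg (1 - z)
  have h3 := lt_of_le_of_ne (Complex.arg_le_pi (1 - z)) h1.1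
  rw [slitSqrt, Complex.exp_re]
  have : (Complex.log (1 - z) / 2).im = Complex.arg (1 - z) / 2 := by
    rw [Complex.div_ofNat_im, Complex.log_im]
  rw [this]
  exact mul_pos (Real.exp_pos _) (Real.cos_pos_of_mem_Ioo ⟨by linarith, by linarith⟩)

theorem differentiableOn_slitSqrt : DifferentiableOn ℂ slitSqrt gaussDomain := fun z hz => by
  have : DifferentiableAt ℂ (fun z : ℂ => Complex.log (1 - z)) z :=
    DifferentiableAt.clog (by fun_prop) hz
  exact (this.div_const 2).cexp.differentiableWithinAt

theorem norm_cayley_lt_one {s : ℂ} (hs : 0 < s.re) : ‖(1 - s) / (1 + s)‖ < 1 := by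
  have h1 : 1 + s ≠ 0 := fun h => by
    have := congrArg Complex.re h
    simp at this
    linarith
  rw [norm_div, div_lt_one (norm_pos_iff.2 h1)]
  refine lt_of_pow_lt_pow_left₀ 2 (norm_nonneg _) ?_
  rw [Complex.sq_norm, Complex.sq_norm, Complex.normSq_apply, Complex.normSq_apply]
  simp
  nlinarith

/-- The pullback under `z = 4 w / (1 + w) ^ 2` has finite singularities only at `0` and `±1`, so its
Taylor series converges in the whole unit disc. The map is inverted on the cut plane by the Cayley
transform of `√(1 - z)`, which lands in that disc. The factor `(1 + w) ^ (-2 * a)` cancels an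
exponent at `w = -1` (that is, `z = ∞`) and so keeps the recurrence three-term. -/
theorem exists_isGaussHypergeometric {c : ℂ} (hc : ∀ n : ℕ, c ≠ -(n : ℂ)) (a b : ℂ) :
    ∃ F : ℂ → ℂ, IsGaussHypergeometric a b c F ∧
      HasTaylor F 0 (ordinaryHypergeometricCoefficient a b c) := by
  obtain ⟨G, hGt⟩ := exists_hasTaylor_hypergeometric hc a b
  set Φ : ℂ → ℂ := fun w => (1 + w) ^ (-2 * a) * G (4 * w / (1 + w) ^ 2) with hΦ
  have hΦa : AnalyticAt ℂ Φ 0 := by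
    refine AnalyticAt.mul ?_ ?_
    · exact AnalyticAt.cpow (by fun_prop) (by fun_prop) (by simp)
    · refine AnalyticAt.fun_comp (g := G) (f := fun w : ℂ => 4 * w / (1 + w) ^ 2) ?_ ?_
      · simpa using hGt.analyticAt
      · exact AnalyticAt.div (by fun_prop) (by fun_prop) (by simp)
  have hk := HasTaylor.of_analyticAt hΦa
  set k : ℕ → ℂ := fun n => iteratedDeriv n Φ 0 / n.factorial
  have hrec := ((hk.triOp 1 0 (-1) (2 + 4 * a - c) (4 * b - 2 * c) (-c) (2 * a * (2 * a + 1 - c))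
    (4 * a * b - 2 * a * c)).eventually_zero_iff).1
      (quadratic_triOp hGt.analyticAt (hypergeometric_triOp hc hGt))
  obtain ⟨hu, hv⟩ := quadratic_recurrence_limits a b c
  obtain ⟨K, hK, hKt⟩ := HasTaylor.exists_of_bound (a := k) (c := 0) fun ρ hρ =>
    bound_of_recurrence hu hv (fun n => by
      have h1 : c + 1 + n ≠ 0 := by
        have := add_natCast_ne_zero hc (n + 1)
        push_cast at this
        rwa [add_assoc, add_comm 1]
      have h2 : (2 + n : ℂ) ≠ 0 := by
        have : ((2 + n : ℕ) : ℂ) ≠ 0 := Nat.cast_ne_zero.2 (by omega)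
        exact_mod_cast this
      have := hrec (n + 1)
      simp only [triCoeff] at this
      field_simp
      linear_combination -this) ρ.2 hρ
  have hKΦ : ∀ᶠ w in 𝓝 0, K w = Φ w := by
    have := (hKt.add (hk.const_mul (-1))).eventually_zero_iff.2 fun n => by ring
    filter_upwards [this] with w hw
    linear_combination hw
  set W : ℂ → ℂ := fun z => (1 - slitSqrt z) / (1 + slitSqrt z) with hW
  have hne : ∀ z ∈ gaussDomain, 1 + slitSqrt z ≠ 0 := fun z hz h => by
    have := congrArg Complex.re h
    have := slitSqrt_re_pos hz
    simp at *
    linarith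
  have hWd : DifferentiableOn ℂ W gaussDomain :=
    (differentiableOn_slitSqrt.const_sub 1).div (differentiableOn_slitSqrt.const_add 1) hne
  have hWm : ∀ z ∈ gaussDomain, W z ∈ Metric.ball (0 : ℂ) 1 := fun z hz => by
    rw [mem_ball_zero_iff]
    exact norm_cayley_lt_one (slitSqrt_re_pos hz)
  have hWs : ∀ z ∈ gaussDomain, 1 + W z ∈ Complex.slitPlane := fun z hz => by
    have h1 := hWm z hz
    rw [Metric.mem_ball, dist_zero_right] at h1
    refine Or.inl ?_
    have := Complex.abs_re_le_norm (W z)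
    rw [abs_le] at this
    simp
    linarith
  have hFd : DifferentiableOn ℂ (fun z => (1 + W z) ^ (2 * a) * K (W z)) gaussDomain :=
    ((hWd.const_add 1).cpow (differentiableOn_const _) hWs).mul (hK.comp hWd hWm)
  have hFt : HasTaylor (fun z => (1 + W z) ^ (2 * a) * K (W z)) 0
      (ordinaryHypergeometricCoefficient a b c) := by
    refine hGt.congr ?_
    have hW0 : Tendsto W (𝓝 0) (𝓝 0) := by
      have : ContinuousAt W 0 := (hWd.differentiableAt
        (isOpen_gaussDomain.mem_nhds zero_mem_gaussDomain)).continuousAt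
      have h0 : W 0 = 0 := by simp [hW, slitSqrt]
      rwa [ContinuousAt, h0] at this
    filter_upwards [hW0.eventually hKΦ, isOpen_gaussDomain.mem_nhds zero_mem_gaussDomain]
      with z hz hzg
    have h1 := Complex.slitPlane_ne_zero (hWs z hzg)
    rw [hz, hΦ]
    have h2 : 4 * W z / (1 + W z) ^ 2 = z := by
      have h3 := hne z hzg
      have h4 := slitSqrt_sq hzg
      have h5 : 1 + W z = 2 / (1 + slitSqrt z) := by
        rw [hW]
        field_simp
        ring
      rw [h5, hW]
      field_simp
      linear_combination -4 * h4
    simp only [h2]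
    rw [← mul_assoc, ← Complex.cpow_add _ _ h1]
    simp
  exact ⟨_, .of_hasTaylor hc hFd hFt, hFt⟩

/-! ### The functional on jets at `t` and the adjoint recurrence -/

/-- Expression number `M` contains `a (M + 1)` with the factor `p₁ * M + r₀ = 0`, so the first `M +
1` expressions form a square system in `a 0, …, a M`. It has a nonzero kernel vector, hence a proper
range, which some nonzero functional annihilates. -/
theorem exists_functional_of_triCoeff_eq_zero {p₃ p₂ p₁ r₂ r₁ r₀ s₁ s₀ : ℂ} {M : ℕ} {a : ℕ → ℂ}
    (hM : p₁ * M + r₀ = 0) (ha0 : a 0 ≠ 0)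
    (ha : ∀ n, triCoeff p₃ p₂ p₁ r₂ r₁ r₀ s₁ s₀ a n = 0) :
    ∃ l : Fin (M + 1) → ℂ, l ≠ 0 ∧
      ∀ b, ∑ j : Fin (M + 1), l j * triCoeff p₃ p₂ p₁ r₂ r₁ r₀ s₁ s₀ b j = 0 := by
  let e : (Fin (M + 1) → ℂ) → ℕ → ℂ := fun v n => if h : n < M + 1 then v ⟨n, h⟩ else 0
  have e_add : ∀ v w n, e (v + w) n = e v n + e w n := fun v w n => by
    by_cases h : n < M + 1 <;> simp only [e, h, dite_true, dite_false] <;> simp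
  have e_smul : ∀ (k : ℂ) v n, e (k • v) n = k * e v n := fun k v n => by
    by_cases h : n < M + 1 <;> simp only [e, h, dite_true, dite_false] <;> simp
  let T : (Fin (M + 1) → ℂ) →ₗ[ℂ] (Fin (M + 1) → ℂ) :=
    { toFun := fun v j => triCoeff p₃ p₂ p₁ r₂ r₁ r₀ s₁ s₀ (e v) j
      map_add' := fun v w => by
        funext j
        rcases j with ⟨_ | j, hj⟩ <;> simp only [triCoeff, e_add, Pi.add_apply] <;> ring
      map_smul' := fun k v => by
        funext j
        rcases j with ⟨_ | j, hj⟩ <;>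
          simp only [triCoeff, e_smul, Pi.smul_apply, smul_eq_mul, RingHom.id_apply] <;> ring }
  have hT : ∀ b : ℕ → ℂ, T (fun j => b j) = fun j : Fin (M + 1) =>
      triCoeff p₃ p₂ p₁ r₂ r₁ r₀ s₁ s₀ b j := fun b => by
    funext j
    have he : ∀ n, n < M + 1 → e (fun j => b j) n = b n := fun n h => by
      simp only [e, h, dite_true]
    rcases j with ⟨_ | j, hj⟩
    · simp only [T, LinearMap.coe_mk, AddHom.coe_mk, triCoeff, he 0 (by omega)]
      rcases Nat.eq_zero_or_pos M with h | h
      · subst h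
        have : r₀ = 0 := by simpa using hM
        simp [this]
      · rw [he 1 (by omega)]
    · simp only [T, LinearMap.coe_mk, AddHom.coe_mk, triCoeff, he j (by omega),
        he (j + 1) (by omega)]
      rcases Nat.lt_or_ge (j + 2) (M + 1) with h | h
      · rw [he (j + 2) h]
      -- Last row: `e` replaces `b (M + 1)` by `0`, harmlessly, as its coefficient vanishes.
      · have : M = j + 1 := by omega
        subst this
        push_cast at hM
        simp [hM]
  have hinj : ¬ Function.Injective T := fun h => by
    have h0 : T (fun j => a j) = T 0 := by
      rw [hT, map_zero]
      funext j
      exact ha j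
    exact ha0 (congrFun (h h0) 0)
  have hlt : LinearMap.range T < ⊤ := by
    rw [lt_top_iff_ne_top, Ne, LinearMap.range_eq_top]
    exact fun h => hinj (LinearMap.injective_iff_surjective.2 h)
  obtain ⟨Λ, hΛ, hker⟩ := Submodule.exists_le_ker_of_lt_top _ hlt
  have hrep : ∀ v, Λ v = ∑ j, Λ (Pi.single j 1) * v j := fun v => by
    rw [LinearMap.pi_apply_eq_sum_univ Λ v]
    refine Finset.sum_congr rfl fun j _ => ?_
    rw [smul_eq_mul, mul_comm]
    congr 2
    funext i
    simp [Pi.single_apply, eq_comm]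
  refine ⟨fun j => Λ (Pi.single j 1), fun h => hΛ ?_, fun b => ?_⟩
  · ext1 j
    ext
    simpa using congrFun h j
  · have : Λ (T fun j => b j) = 0 := hker ⟨_, rfl⟩
    rwa [hT, hrep] at this

theorem hasTaylor_pow (n : ℕ) (t : ℂ) :
    HasTaylor (fun z => z ^ n) t (fun j => n.choose j * t ^ (n - j)) := by
  rw [HasTaylor.iff_hasSum]
  refine Eventually.of_forall fun z => ?_
  rw [add_comm t z, add_pow]
  have h := hasSum_sum_of_ne_finset_zero (L := .unconditional ℕ)
    (f := fun j => z ^ j * (n.choose j * t ^ (n - j)))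
    (s := Finset.range (n + 1)) fun j hj => by
      rw [Nat.choose_eq_zero_of_lt (by simpa using hj)]
      simp
  rwa [Finset.sum_congr rfl fun j _ => show z ^ j * t ^ (n - j) * (n.choose j : ℂ) =
    z ^ j * (n.choose j * t ^ (n - j)) by ring]

/-- Heun's operator with the denominators cleared. -/
noncomputable def heunOp (α β γ δ ε t q : ℂ) (y : ℂ → ℂ) (z : ℂ) : ℂ :=
  z * (z - 1) * (z - t) * deriv (deriv y) z
    + (γ * (z - 1) * (z - t) + δ * z * (z - t) + ε * z * (z - 1)) * deriv y z
    + (α * β * z - q) * y z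

theorem heunOp_eq_mul_heunLHS {α β γ δ ε t q : ℂ} {y : ℂ → ℂ} {z : ℂ} (h0 : z ≠ 0) (h1 : z ≠ 1)
    (ht : z ≠ t) :
    heunOp α β γ δ ε t q y z = z * (z - 1) * (z - t) * heunLHS α β γ δ ε t q y z := by
  have h1' := sub_ne_zero.2 h1
  have ht' := sub_ne_zero.2 ht
  rw [heunOp, heunLHS]
  field_simp

theorem heunOp_eq_triOp_zero (α β γ δ ε t q : ℂ) (y : ℂ → ℂ) :
    heunOp α β γ δ ε t q y = triOp 1 (-(1 + t)) t (γ + δ + ε) (-(γ * (1 + t) + δ * t + ε)) (γ * t)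
      (α * β) (-q) 0 y := by
  funext z
  simp only [heunOp, triOp]
  ring

theorem heunOp_eq_triOp (α β γ δ ε t q : ℂ) (y : ℂ → ℂ) :
    heunOp α β γ δ ε t q y = triOp 1 (2 * t - 1) (t * (t - 1)) (γ + δ + ε)
      (γ * (t - 1) + δ * t + ε * (2 * t - 1)) (ε * t * (t - 1)) (α * β) (α * β * t - q) t y := by
  funext z
  simp only [heunOp, triOp]
  ring

theorem heunOp_pow_succ {α β γ δ ε t q : ℂ} (hsum : γ + δ + ε = α + β + 1) (n : ℕ) (z : ℂ) :
    heunOp α β γ δ ε t q (fun z => z ^ (n + 1)) z =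
      (n + 1 + α) * (n + 1 + β) * z ^ (n + 2)
      + (-((n + 1) * (n * (1 + t) + γ * (1 + t) + δ * t + ε) + q) * z ^ (n + 1)
      + t * (n + 1) * (n + γ) * z ^ n) := by
  have h1 : deriv (fun z : ℂ => z ^ (n + 1)) = fun z : ℂ => (n + 1) * z ^ n := by
    funext z
    simp
  have h2 : z * deriv (fun z : ℂ => (n + 1) * z ^ n) z = (n + 1) * n * z ^ n := by
    rcases n with _ | n
    · simp
    · simp
      ring
  simp only [heunOp, h1]
  linear_combination (z - 1) * (z - t) * h2 + (n + 1) * z ^ (n + 2) * hsum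

theorem heunOp_pow_zero (α β γ δ ε t q z : ℂ) :
    heunOp α β γ δ ε t q (fun z => z ^ 0) z = α * β * z ^ 1 + -q * z ^ 0 := by
  simp [heunOp, sub_eq_add_neg]

theorem triCoeff_eq_zero_of_heun {α β γ δ ε t q : ℂ} (ht0 : t ≠ 0) (ht1 : t ≠ 1) {f : ℂ → ℂ}
    {a : ℕ → ℂ} (hf : HasTaylor f t a)
    (h : ∀ᶠ z in 𝓝[≠] t, heunLHS α β γ δ ε t q f z = 0) (n : ℕ) :
    triCoeff 1 (2 * t - 1) (t * (t - 1)) (γ + δ + ε)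
      (γ * (t - 1) + δ * t + ε * (2 * t - 1)) (ε * t * (t - 1)) (α * β) (α * β * t - q) a n = 0 := by
  have hT := hf.triOp 1 (2 * t - 1) (t * (t - 1)) (γ + δ + ε)
      (γ * (t - 1) + δ * t + ε * (2 * t - 1)) (ε * t * (t - 1)) (α * β) (α * β * t - q)
  rw [← heunOp_eq_triOp] at hT
  refine hT.eventually_zero_iff.1 ?_ n
  have h' : ∀ᶠ z in 𝓝[≠] t, heunOp α β γ δ ε t q f z = 0 := by
    filter_upwards [h, self_mem_nhdsWithin, nhdsWithin_le_nhds (isOpen_ne.mem_nhds ht0),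
      nhdsWithin_le_nhds (isOpen_ne.mem_nhds ht1)] with z hz h1 h2 h3
    rw [heunOp_eq_mul_heunLHS h2 h3 h1, hz, mul_zero]
  exact hT.analyticAt.frequently_zero_iff_eventually_zero.1 h'.frequently

/-- The adjoint difference equation of the recurrence for the coefficients at `0` of solutions of
Heun's equation has a polynomial solution, if the equation has a solution which is holomorphic and
nonzero at `t`. -/
theorem exists_polynomial_of_heun {α β γ δ ε t q : ℂ} {M : ℕ} (hM : ε = -M)
    (hsum : γ + δ + ε = α + β + 1) (ht0 : t ≠ 0) (ht1 : t ≠ 1) {f : ℂ → ℂ} (hf : AnalyticAt ℂ f t)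
    (hft : f t ≠ 0) (h : ∀ᶠ z in 𝓝[≠] t, heunLHS α β γ δ ε t q f z = 0) :
    ∃ P : ℂ[X], P ≠ 0 ∧ t * α * β * P.eval 1 - q * P.eval 0 = 0 ∧
      ∀ n : ℕ, t * (n + 1 + α) * (n + 1 + β) * P.eval (n + 2 : ℂ)
        - ((n + 1) * (n * (1 + t) + γ * (1 + t) + δ * t + ε) + q) * P.eval (n + 1 : ℂ)
        + (n + 1) * (n + γ) * P.eval (n : ℂ) = 0 := by
  have ha := HasTaylor.of_analyticAt hf
  obtain ⟨l, hl, hL⟩ := exists_functional_of_triCoeff_eq_zero (M := M)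
    (by rw [hM]; ring) (by rwa [← ha.apply_center]) (triCoeff_eq_zero_of_heun ht0 ht1 ha h)
  -- `b n` is the jet of `z ^ n` at `t`, and `p n` is the functional evaluated on it.
  set b : ℕ → ℕ → ℂ := fun n j => n.choose j * t ^ (n - j)
  set p : ℕ → ℂ := fun n => ∑ j : Fin (M + 1), l j * b n j
  have hp0 : α * β * p 1 - q * p 0 = 0 := by
    have h1 := (hasTaylor_pow 0 t).triOp 1 (2 * t - 1) (t * (t - 1)) (γ + δ + ε)
      (γ * (t - 1) + δ * t + ε * (2 * t - 1)) (ε * t * (t - 1)) (α * β) (α * β * t - q)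
    rw [← heunOp_eq_triOp, funext (heunOp_pow_zero α β γ δ ε t q)] at h1
    have h2 := h1.unique (((hasTaylor_pow 1 t).const_mul _).add ((hasTaylor_pow 0 t).const_mul _))
    have h3 := hL (b 0)
    rw [h2] at h3
    rw [← h3, Finset.mul_sum, Finset.mul_sum, ← Finset.sum_sub_distrib]
    exact Finset.sum_congr rfl fun j _ => by simp only [b]; ring
  have hp : ∀ n : ℕ, (n + 1 + α) * (n + 1 + β) * p (n + 2)
        - ((n + 1) * (n * (1 + t) + γ * (1 + t) + δ * t + ε) + q) * p (n + 1)
        + t * (n + 1) * (n + γ) * p n = 0 := fun n => by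
    have h1 := (hasTaylor_pow (n + 1) t).triOp 1 (2 * t - 1) (t * (t - 1)) (γ + δ + ε)
      (γ * (t - 1) + δ * t + ε * (2 * t - 1)) (ε * t * (t - 1)) (α * β) (α * β * t - q)
    rw [← heunOp_eq_triOp, funext (heunOp_pow_succ hsum n)] at h1
    have h2 := h1.unique (((hasTaylor_pow (n + 2) t).const_mul _).add
      (((hasTaylor_pow (n + 1) t).const_mul _).add ((hasTaylor_pow n t).const_mul _)))
    have h3 := hL (b (n + 1))
    rw [h2] at h3
    rw [← h3, Finset.mul_sum, Finset.mul_sum, Finset.mul_sum, ← Finset.sum_sub_distrib,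
      ← Finset.sum_add_distrib]
    exact Finset.sum_congr rfl fun j _ => by simp only [b]; ring
  -- Comes from `n.choose j * t ^ (n - j) = t ^ n * descPochhammer n / (j! * t ^ j)`, where both
  -- sides vanish for `j > n`.
  set P : ℂ[X] := ∑ j : Fin (M + 1), C (l j / t ^ (j : ℕ) / (j : ℕ).factorial) *
    descPochhammer ℂ j
  have hP : ∀ n : ℕ, p n = t ^ n * P.eval (n : ℂ) := fun n => by
    simp only [p, P, eval_finsetSum, eval_mul, eval_C, Finset.mul_sum]
    refine Finset.sum_congr rfl fun j _ => ?_
    rw [descPochhammer_eval_eq_descFactorial, Nat.descFactorial_eq_factorial_mul_choose]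
    have : ((j : ℕ).factorial : ℂ) ≠ 0 := by exact_mod_cast (j : ℕ).factorial_ne_zero
    rcases le_or_gt (j : ℕ) n with hj | hj
    · simp only [b]
      have : t ^ n = t ^ (n - j) * t ^ (j : ℕ) := by rw [← pow_add, Nat.sub_add_cancel hj]
      rw [this]
      push_cast
      field_simp
    · simp [b, Nat.choose_eq_zero_of_lt hj]
  have htn : ∀ n : ℕ, t ^ n ≠ 0 := fun n => pow_ne_zero n ht0
  refine ⟨P, fun h0 => hl ?_, ?_, fun n => ?_⟩
  · have hpz : ∀ n, p n = 0 := fun n => by rw [hP, h0]; simp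
    -- The matrix `b` is triangular with unit diagonal, so vanishing of all `p n` forces `l = 0`.
    have : ∀ n (hn : n < M + 1), l ⟨n, hn⟩ = 0 := fun n => by
      induction n using Nat.strong_induction_on with
      | _ n ih =>
        intro hn
        have := hpz n
        simp only [p] at this
        rw [Finset.sum_eq_single ⟨n, hn⟩] at this
        · simpa [b] using this
        · intro j _ hj
          rcases lt_trichotomy (j : ℕ) n with h | h | h
          · rw [show l j = 0 from ih j h j.2, zero_mul]
          · exact absurd (Fin.ext h) hj
          · simp [b, Nat.choose_eq_zero_of_lt h]
        · simp
    exact funext fun j => this j j.2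
  · have h0 := hP 0
    have h1 := hP 1
    push_cast at h0 h1
    rw [h0, h1] at hp0
    linear_combination hp0
  · have h0 := hP n
    have h1 := hP (n + 1)
    have h2 := hP (n + 2)
    have := hp n
    push_cast at h0 h1 h2
    rw [h0, h1, h2] at this
    apply mul_left_cancel₀ (htn (n + 1))
    linear_combination this

/-! ### A Heun solution at `0` from contiguous hypergeometric functions -/

theorem isPreconnected_gaussDomain : IsPreconnected gaussDomain := by
  have h := (Complex.starConvex_one_slitPlane.isPathConnected Complex.one_mem_slitPlane).isConnected.isPreconnected
  have := h.image (fun z : ℂ => 1 - z) (by fun_prop)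
  convert this using 1
  ext z
  exact ⟨fun hz => ⟨1 - z, hz, by ring⟩, by rintro ⟨w, hw, rfl⟩; simpa [gaussDomain] using hw⟩

theorem ascPochhammer_eval_shift (a : ℂ) (n k : ℕ) :
    (ascPochhammer ℂ k).eval (n + a) * (ascPochhammer ℂ n).eval a =
      (ascPochhammer ℂ k).eval a * (ascPochhammer ℂ n).eval (a + k) := by
  have h1 := congrArg (eval a) (ascPochhammer_mul ℂ n k)
  have h2 := congrArg (eval a) (ascPochhammer_mul ℂ k n)
  simp only [eval_mul, eval_comp, eval_add, eval_X, eval_natCast] at h1 h2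
  rw [add_comm k n, ← h1] at h2
  rw [h2, add_comm (n : ℂ) a, mul_comm]

/-- The shifted rising factorials, which form a basis of the space of polynomials. -/
noncomputable def risingSequence (a : ℂ) : Polynomial.Sequence ℂ where
  elems' k := (ascPochhammer ℂ k).comp (X + C a)
  degree_eq' k := by
    have h : ((ascPochhammer ℂ k).comp (X + C a)).Monic := (monic_ascPochhammer ℂ k).comp_X_add_C a
    rw [degree_eq_natDegree h.ne_zero, natDegree_comp, ascPochhammer_natDegree, natDegree_X_add_C,
      mul_one]

/-- Polynomial multiples of the coefficients of a hypergeometric series give finite linear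
combinations of contiguous hypergeometric functions. -/
theorem exists_mem_span_hasTaylor (a : ℂ) {c : ℂ}
    (hc : ∀ n : ℕ, c ≠ -(n : ℂ)) (b : ℂ) (Q : ℂ[X]) :
    ∃ y ∈ Submodule.span ℂ {F | ∃ a', IsGaussHypergeometric a' b c F},
      DifferentiableOn ℂ y gaussDomain ∧
      HasTaylor y 0 (fun n => Q.eval (n : ℂ) * ordinaryHypergeometricCoefficient a b c n) := by
  have hQ : Q ∈ Submodule.span ℂ (Set.range (risingSequence a)) := by
    rw [(risingSequence a).span fun i => isUnit_iff_ne_zero.2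
      (leadingCoeff_ne_zero.2 ((risingSequence a).ne_zero i))]
    trivial
  induction hQ using Submodule.span_induction with
  | mem Q h =>
    obtain ⟨k, rfl⟩ := h
    obtain ⟨F, hF, hFt⟩ := exists_isGaussHypergeometric hc (a + k) b
    refine ⟨(ascPochhammer ℂ k).eval a • F, Submodule.smul_mem _ _ (Submodule.subset_span ⟨_, hF⟩),
      hF.2.1.const_smul _, ?_⟩
    -- A rising factorial in `a + n` is absorbed by raising the parameter: `(a + n)_k (a)_n = (a)_k
    -- (a + k)_n`.
    have key : ∀ n : ℕ, eval (n : ℂ) (risingSequence a k) *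
        ordinaryHypergeometricCoefficient a b c n = (ascPochhammer ℂ k).eval a *
          ordinaryHypergeometricCoefficient (a + k) b c n := fun n => by
      have e : eval (n : ℂ) (risingSequence a k) = (ascPochhammer ℂ k).eval (n + a) := by
        change eval (n : ℂ) ((ascPochhammer ℂ k).comp (X + C a)) = _
        simp [eval_comp]
      rw [e]
      simp only [ordinaryHypergeometricCoefficient]
      linear_combination ((n.factorial : ℂ)⁻¹ * (ascPochhammer ℂ n).eval b *
        ((ascPochhammer ℂ n).eval c)⁻¹) * ascPochhammer_eval_shift a n k
    rw [funext key]
    exact hFt.const_mul _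
  | zero =>
    refine ⟨0, Submodule.zero_mem _, differentiableOn_const _, ?_⟩
    simp only [eval_zero, zero_mul]
    exact HasTaylor.zero
  | add Q₁ Q₂ _ _ h₁ h₂ =>
    obtain ⟨y₁, h1, h2, h3⟩ := h₁
    obtain ⟨y₂, h4, h5, h6⟩ := h₂
    refine ⟨y₁ + y₂, Submodule.add_mem _ h1 h4, h2.add h5, ?_⟩
    simp only [eval_add, add_mul]
    exact h3.add h6
  | smul k Q _ h =>
    obtain ⟨y, h1, h2, h3⟩ := h
    refine ⟨k • y, Submodule.smul_mem _ _ h1, h2.const_smul _, ?_⟩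
    have e : (fun n : ℕ => (k • Q).eval (n : ℂ) * ordinaryHypergeometricCoefficient a b c n) =
        fun n : ℕ => k * (Q.eval (n : ℂ) * ordinaryHypergeometricCoefficient a b c n) :=
      funext fun n : ℕ => by rw [eval_smul, smul_eq_mul, mul_assoc]
    rw [e]
    exact h3.const_mul k

theorem HasTaylor.pow_mul {f : ℂ → ℂ} {a : ℕ → ℂ} (h : HasTaylor f 0 a) (m : ℕ) :
    HasTaylor (fun z => z ^ m * f z) 0 (fun n => if n < m then 0 else a (n - m)) := by
  induction m with
  | zero => simpa using h
  | succ m ih =>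
    convert ih.sub_mul using 1
    · funext z
      ring
    · funext n
      rcases n with _ | n <;> simp [HasTaylor.shift]

/-- The functions that are combinations of the standard solutions of hypergeometric equations both
as they stand and after the substitution of `1 - z` for `z`. -/
def hypergeometricSpan : Submodule ℂ (ℂ → ℂ) :=
  Submodule.span ℂ {ψ | IsHypergeometricSolution ψ ∧ IsHypergeometricSolution fun z => ψ (1 - z)}

theorem pow_mul_mem_hypergeometricSpan {m : ℕ} {b c : ℂ} (hm : m = 0 ∨ c - 1 = m) {y : ℂ → ℂ}
    (hy : y ∈ Submodule.span ℂ {F | ∃ a', IsGaussHypergeometric a' b c F}) :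
    (fun z => z ^ m * y z) ∈ hypergeometricSpan := by
  induction hy using Submodule.span_induction with
  | mem F h =>
    obtain ⟨a, hF⟩ := h
    refine Submodule.subset_span ?_
    rcases hm with rfl | hm
    · exact ⟨⟨a, b, c, F, hF, Or.inl fun z _ => by simp⟩,
        ⟨a, b, c, F, hF, Or.inr (Or.inr (Or.inl fun z _ => by simp))⟩⟩
    · exact ⟨⟨a, b, c, F, hF, Or.inr (Or.inl fun z _ => by rw [hm, Complex.cpow_natCast])⟩,
        ⟨a, b, c, F, hF, Or.inr (Or.inr (Or.inr fun z _ => by rw [hm, Complex.cpow_natCast]))⟩⟩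
  | zero =>
    convert Submodule.zero_mem hypergeometricSpan using 1
    funext z
    simp
  | add y₁ y₂ _ _ h₁ h₂ =>
    convert Submodule.add_mem _ h₁ h₂ using 1
    funext z
    simp [mul_add]
  | smul k y _ h =>
    convert Submodule.smul_mem _ k h using 1
    funext z
    simp [mul_left_comm]

theorem exists_norm_eval_ge {P : ℂ[X]} (hP : P ≠ 0) :
    ∃ k > 0, ∀ᶠ n : ℕ in atTop, k ≤ ‖P.eval (n : ℂ)‖ := by
  rcases le_or_gt P.degree 0 with h | h
  · rw [eq_C_of_degree_le_zero h] at hP ⊢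
    refine ⟨‖P.coeff 0‖, norm_pos_iff.2 (by simpa using hP), Eventually.of_forall fun n => ?_⟩
    simp
  · refine ⟨1, one_pos, ?_⟩
    have : Tendsto (fun n : ℕ => ‖(n : ℂ)‖) atTop atTop := by
      simpa using tendsto_natCast_atTop_atTop (R := ℝ)
    exact (P.tendsto_norm_atTop h this).eventually_ge_atTop 1

/-- A power series whose coefficients are a polynomial multiple of those of a proper hypergeometric
series does not extend to an entire function. -/
theorem not_entire_of_ratio {g v : ℕ → ℂ} {P : ℂ[X]} (hP : P ≠ 0) (hv : Tendsto v atTop (𝓝 1))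
    (hg0 : ∀ᶠ n in atTop, g n ≠ 0) (hg : ∀ᶠ n in atTop, g (n + 1) = v n * g n) {Y : ℂ → ℂ}
    (hY : Differentiable ℂ Y) (h : HasTaylor Y 0 fun n => P.eval (n : ℂ) * g n) : False := by
  have h1 := (h.hasSum_of_differentiableOn (r := 3) hY.differentiableOn (z := 2)
    (by simp; norm_num)).summable
  obtain ⟨k, hk, hkP⟩ := exists_norm_eval_ge hP
  -- `P` is eventually bounded away from `0`, so convergence at `2` passes to the series of `g`,
  -- contradicting the ratio test.
  have h2 : Summable fun n => (2 : ℂ) ^ n * g n := by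
    refine summable_of_isBigO_nat h1.norm (Asymptotics.IsBigO.of_bound k⁻¹ ?_)
    filter_upwards [hkP] with n hn
    rw [norm_norm, inv_mul_eq_div, le_div_iff₀ hk, sub_zero, norm_mul, norm_mul, norm_mul]
    nlinarith [mul_le_mul_of_nonneg_right hn (by positivity : 0 ≤ ‖(2 : ℂ) ^ n‖ * ‖g n‖)]
  refine not_summable_of_ratio_test_tendsto_gt_one (l := 2) (by norm_num) ?_ h2
  have h3 : Tendsto (fun n => 2 * ‖v n‖) atTop (𝓝 2) := by
    simpa using hv.norm.const_mul 2
  refine h3.congr' ?_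
  filter_upwards [hg0, hg] with n h0 hn
  have : ‖g n‖ ≠ 0 := norm_ne_zero_iff.2 h0
  rw [hn, norm_mul, norm_mul, norm_mul, norm_pow, norm_pow]
  have : ‖(2 : ℂ)‖ = 2 := by simp
  rw [this]
  field_simp
  ring

theorem analyticOnNhd_heunOp {α β γ δ ε t q : ℂ} {y : ℂ → ℂ} {U : Set ℂ} (hU : IsOpen U)
    (hy : DifferentiableOn ℂ y U) : AnalyticOnNhd ℂ (heunOp α β γ δ ε t q y) U := by
  have h := hy.analyticOnNhd hU
  intro z hz
  have h0 := h z hz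
  have h1 := h0.deriv
  have h2 := h1.deriv
  unfold heunOp
  fun_prop

/-- `m` is an exponent at `0`: normally `0`, but `1 - γ` when `γ` is a nonpositive integer. In the
latter case the lower parameter becomes `2 - γ`, which is admissible. -/
theorem exists_exponent_shift (γ : ℂ) :
    ∃ m : ℕ, m * (m + γ - 1) = 0 ∧ (m = 0 ∨ γ + 2 * m - 1 = m) ∧
      ∀ n : ℕ, γ + 2 * m ≠ -(n : ℂ) := by
  by_cases h : ∃ k : ℕ, γ = -(k : ℂ)
  · obtain ⟨k, rfl⟩ := h
    refine ⟨k + 1, ?_, Or.inr ?_, fun n hn => ?_⟩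
    · push_cast
      ring
    · push_cast
      ring
    · push_cast at hn
      have : ((k + n + 2 : ℕ) : ℂ) = 0 := by
        push_cast
        linear_combination hn
      rw [Nat.cast_eq_zero] at this
      omega
  · push Not at h
    exact ⟨0, by simp, Or.inl rfl, by simpa using h⟩

/-- In Heun's recurrence for `P n * g n`, the recursion of `g` rewrites both outer terms as
multiples of `g (n + 1)`; the cofactor is the adjoint recurrence of `P`. The series does not
terminate since `α + m + k` and `β + m + k` never vanish. -/
theorem exists_heun_solution_of_apparent {α β γ δ ε t q : ℂ} {M : ℕ} (hM : ε = -M)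
    (hsum : γ + δ + ε = α + β + 1) (ht0 : t ≠ 0) (ht1 : t ≠ 1) (hα : ∀ n : ℤ, α ≠ n)
    (hβ : ∀ n : ℤ, β ≠ n) {f : ℂ → ℂ} (hf : AnalyticAt ℂ f t) (hft : f t ≠ 0)
    (h : ∀ᶠ z in 𝓝[≠] t, heunLHS α β γ δ ε t q f z = 0) :
    ∃ y ∈ hypergeometricSpan, DifferentiableOn ℂ y gaussDomain ∧
      (∀ z ∈ gaussDomain, heunOp α β γ δ ε t q y z = 0) ∧
      ∀ Y : ℂ → ℂ, Differentiable ℂ Y → ¬ Y =ᶠ[𝓝 0] y := by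
  obtain ⟨P, hP, hP0, hPn⟩ := exists_polynomial_of_heun hM hsum ht0 ht1 hf hft h
  obtain ⟨m, hm, hm', hc⟩ := exists_exponent_shift γ
  have hadd : ∀ {x : ℂ}, (∀ n : ℤ, x ≠ n) → ∀ k : ℕ, ∀ n : ℕ, x + k ≠ -(n : ℂ) :=
    fun hx k n hn => hx (-(n : ℤ) - k) (by push_cast; linear_combination hn)
  obtain ⟨y, hy, hyd, hyt⟩ := exists_mem_span_hasTaylor (α + m) hc (β + m) (P.comp (X + C (m : ℂ)))
  set u := ordinaryHypergeometricCoefficient (α + m) (β + m) (γ + 2 * m) with hu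
  have hu' : ∀ k : ℕ, (k + 1) * (γ + 2 * m + k) * u (k + 1) = (α + m + k) * (β + m + k) * u k :=
    fun k => hypergeometricCoefficient_succ hc _ _ k
  set g : ℕ → ℂ := fun n => if n < m then 0 else u (n - m) with hg
  have hgm : ∀ k, g (m + k) = u k := fun k => by simp [hg]
  have hgr : ∀ n : ℕ, (n + 1) * (n + γ) * g (n + 1) = (n + α) * (n + β) * g n := fun n => by
    rcases lt_trichotomy (n + 1) m with hn | hn | hn
    · simp [hg, hn, (Nat.lt_succ_self n).trans hn]
    -- Where the series starts, `g n = 0` and `g (n + 1)` is multiplied by the indicial polynomial,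
    -- which is `0` at `m`.
    · rw [← hn] at hm
      push_cast at hm
      have : g n = 0 := by simp [hg, ← hn]
      rw [this]
      linear_combination g (n + 1) * hm
    · obtain ⟨k, rfl⟩ : ∃ k, n = m + k := ⟨n - m, by omega⟩
      rw [hgm, add_assoc, hgm]
      push_cast
      linear_combination hu' k + u (k + 1) * hm
  have hyt' : HasTaylor (fun z => z ^ m * y z) 0 (fun n => P.eval (n : ℂ) * g n) := by
    convert hyt.pow_mul m using 2 with n
    by_cases hn : n < m
    · simp [hg, hn]
    · have : ((n - m : ℕ) : ℂ) + m = n := by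
        rw [← Nat.cast_add, Nat.sub_add_cancel (not_lt.1 hn)]
      simp [hg, hn, eval_comp, this]
  have hd : DifferentiableOn ℂ (fun z => z ^ m * y z) gaussDomain :=
    (differentiable_id.pow m).differentiableOn.mul hyd
  refine ⟨_, pow_mul_mem_hypergeometricSpan hm' hy, hd, ?_, fun Y hY hYy => ?_⟩
  · have h0 : ∀ᶠ z in 𝓝 0, heunOp α β γ δ ε t q (fun z => z ^ m * y z) z = 0 := by
      have := hyt'.triOp 1 (-(1 + t)) t (γ + δ + ε) (-(γ * (1 + t) + δ * t + ε)) (γ * t) (α * β) (-q)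
      rw [← heunOp_eq_triOp_zero] at this
      refine this.eventually_zero_iff.2 fun n => ?_
      rcases n with _ | n
      · have h1 := hgr 0
        simp only [triCoeff]
        push_cast at h1 ⊢
        linear_combination t * P.eval 1 * h1 + g 0 * hP0
      · have h1 := hgr (n + 1)
        have h2 := hgr n
        have h3 := hPn n
        simp only [triCoeff]
        push_cast at h1 ⊢
        linear_combination t * P.eval (n + 2 : ℂ) * h1 - P.eval (n : ℂ) * h2 + g (n + 1) * h3
          + n * P.eval (n : ℂ) * g n * hsum
    exact (analyticOnNhd_heunOp isOpen_gaussDomain hd).eqOn_zero_of_preconnected_of_eventuallyEq_zero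
      isPreconnected_gaussDomain zero_mem_gaussDomain h0
  · have hut := hypergeometricCoefficient_ratio_tendsto (α + m) (β + m) (γ + 2 * m)
    refine not_entire_of_ratio hP (hut.comp (tendsto_sub_atTop_nat m)) (g := g) ?_ ?_ hY
      (hyt'.congr hYy.symm)
    · filter_upwards [eventually_ge_atTop m] with n hn
      obtain ⟨k, rfl⟩ : ∃ k, n = m + k := ⟨n - m, by omega⟩
      rw [hgm]
      induction k with
      | zero => simp [hu]
      | succ k ih =>
        intro h0
        have h1 := hu' k
        rw [h0, mul_zero] at h1
        have h2 := add_natCast_ne_zero (hadd hα m) k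
        have h3 := add_natCast_ne_zero (hadd hβ m) k
        exact mul_ne_zero (mul_ne_zero h2 h3) (ih (by omega)) h1.symm
    · filter_upwards [eventually_ge_atTop m] with n hn
      obtain ⟨k, rfl⟩ : ∃ k, n = m + k := ⟨n - m, by omega⟩
      rw [add_assoc, hgm, hgm]
      have h1 := hu' k
      have h2 := add_natCast_ne_zero hc k
      have h3 : (k + 1 : ℂ) ≠ 0 := by exact_mod_cast k.succ_ne_zero
      simp only [Function.comp, Nat.add_sub_cancel_left]
      rw [div_mul_eq_mul_div, eq_div_iff (mul_ne_zero h3 h2)]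
      linear_combination h1

/-! ### Reflection, uniqueness for the equation, and gluing -/

theorem isOpen_doublySlitPlane : IsOpen doublySlitPlane :=
  Complex.isOpen_slitPlane.inter isOpen_gaussDomain

theorem isPreconnected_doublySlitPlane : IsPreconnected doublySlitPlane := by
  have h1 : StarConvex ℝ ((1 / 2 : ℝ) : ℂ) Complex.slitPlane :=
    Complex.starConvex_ofReal_slitPlane (by norm_num)
  have h2 : StarConvex ℝ ((1 / 2 : ℝ) : ℂ) doublySlitPlane := by
    intro z hz a b ha hb hab
    refine ⟨h1 hz.1 ha hb hab, ?_⟩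
    have := h1 hz.2 ha hb hab
    convert this using 1
    have : (a : ℂ) + b = 1 := by exact_mod_cast hab
    simp only [Complex.real_smul]
    push_cast
    linear_combination -this
  refine (h2.isPathConnected ⟨?_, ?_⟩).isConnected.isPreconnected
  · exact Complex.ofReal_mem_slitPlane.2 (by norm_num)
  · rw [← Complex.ofReal_one, ← Complex.ofReal_sub]
    exact Complex.ofReal_mem_slitPlane.2 (by norm_num)

theorem one_sub_mem_gaussDomain {z : ℂ} : 1 - z ∈ gaussDomain ↔ z ∈ Complex.slitPlane := by
  simp [gaussDomain]

theorem gaussDomain_union_slitPlane (z : ℂ) : z ∈ gaussDomain ∨ z ∈ Complex.slitPlane := by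
  simp only [gaussDomain, Set.mem_ofPred_eq, Complex.mem_slitPlane_iff, Complex.sub_re,
    Complex.one_re, Complex.sub_im, Complex.one_im]
  by_cases h : z.im = 0
  · rcases le_or_gt z.re 0 with h1 | h1
    · exact Or.inl (Or.inl (by linarith))
    · exact Or.inr (Or.inl h1)
  · exact Or.inr (Or.inr h)

theorem deriv_comp_one_sub (y : ℂ → ℂ) (z : ℂ) :
    deriv (fun w => y (1 - w)) z = -deriv y (1 - z) :=
  deriv_comp_const_sub y 1 z

theorem deriv_deriv_comp_one_sub (y : ℂ → ℂ) (z : ℂ) :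
    deriv (deriv fun w => y (1 - w)) z = deriv (deriv y) (1 - z) := by
  rw [funext (deriv_comp_one_sub y), deriv.fun_neg, deriv_comp_one_sub, neg_neg]

theorem heunOp_comp_one_sub (α β γ δ ε t q : ℂ) (y : ℂ → ℂ) (z : ℂ) :
    heunOp α β γ δ ε t q (fun w => y (1 - w)) z =
      -heunOp α β δ γ ε (1 - t) (α * β - q) y (1 - z) := by
  simp only [heunOp, deriv_deriv_comp_one_sub, deriv_comp_one_sub]
  ring

theorem heunLHS_comp_one_sub (α β γ δ ε t q : ℂ) (y : ℂ → ℂ) (z : ℂ) :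
    heunLHS α β δ γ ε (1 - t) (α * β - q) (fun w => y (1 - w)) z =
      heunLHS α β γ δ ε t q y (1 - z) := by
  simp only [heunLHS, deriv_deriv_comp_one_sub, deriv_comp_one_sub]
  have e1 : z - 1 = -(1 - z) := by ring
  have e2 : z - (1 - t) = -(1 - z - t) := by ring
  have e3 : (1 - z - 1) = -z := by ring
  rw [e1, e2, e3, div_neg, div_neg, div_neg]
  have e4 : (α * β * z - (α * β - q)) / (z * -(1 - z) * -(1 - z - t)) =
      (α * β * (1 - z) - q) / ((1 - z) * -z * (1 - z - t)) := by
    rw [show z * -(1 - z) * -(1 - z - t) = -((1 - z) * -z * (1 - z - t)) by ring, div_neg, ← neg_div]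
    congr 1
    ring
  rw [e4]
  ring

/-- A solution of a linear homogeneous second order equation vanishes near a point at which it
vanishes together with its derivative. -/
theorem eventually_zero_of_ode {y p r : ℂ → ℂ} {z : ℂ} (hy : AnalyticAt ℂ y z)
    (hp : AnalyticAt ℂ p z) (hr : AnalyticAt ℂ r z)
    (h : ∀ᶠ w in 𝓝 z, deriv (deriv y) w + p w * deriv y w + r w * y w = 0)
    (h0 : y z = 0) (h1 : deriv y z = 0) : ∀ᶠ w in 𝓝 z, y w = 0 := by
  -- Each derivative lowers the vanishing order by one, while the equation makes the order of `y''`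
  -- at least that of `y'`; so the order is infinite.
  have e1 : analyticOrderAt (deriv y) z + 1 = analyticOrderAt y z := by
    simpa [h0] using hy.analyticOrderAt_deriv_add_one
  have e2 : analyticOrderAt (deriv (deriv y)) z + 1 = analyticOrderAt (deriv y) z := by
    simpa [h1] using hy.deriv.analyticOrderAt_deriv_add_one
  have e3 : analyticOrderAt (deriv (deriv y)) z =
      analyticOrderAt (p * deriv y + r * y) z := by
    rw [← analyticOrderAt_neg (f := p * deriv y + r * y)]
    refine analyticOrderAt_congr ?_
    filter_upwards [h] with w hw
    simp only [Pi.neg_apply, Pi.add_apply, Pi.mul_apply]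
    linear_combination hw
  have e4 : analyticOrderAt (deriv y) z ≤ analyticOrderAt (p * deriv y + r * y) z := by
    refine le_trans (le_min ?_ ?_) le_analyticOrderAt_add
    · rw [analyticOrderAt_mul hp hy.deriv]
      exact le_add_self
    · rw [analyticOrderAt_mul hr hy, ← e1]
      exact le_add_self.trans (add_le_add_right le_self_add _)
  rw [← e3, ← e2] at e4
  have e5 : analyticOrderAt (deriv (deriv y)) z = ⊤ := by
    by_contra hne
    exact absurd e4 (not_le.2 (ENat.lt_add_one_iff hne |>.2 le_rfl))
  rw [← analyticOrderAt_eq_top, ← e1, ← e2, e5]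
  simp

theorem deriv_linear_combination {f g : ℂ → ℂ} {z : ℂ} (hf : AnalyticAt ℂ f z)
    (hg : AnalyticAt ℂ g z) (a b : ℂ) :
    deriv (fun w => a * f w + b * g w) z = a * deriv f z + b * deriv g z :=
  ((hf.differentiableAt.hasDerivAt.const_mul a).add
    (hg.differentiableAt.hasDerivAt.const_mul b)).deriv

theorem heunLHS_linear_combination (α β γ δ ε t q : ℂ) {f g : ℂ → ℂ} {z : ℂ}
    (hf : AnalyticAt ℂ f z) (hg : AnalyticAt ℂ g z) (a b : ℂ) :
    heunLHS α β γ δ ε t q (fun w => a * f w + b * g w) z =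
      a * heunLHS α β γ δ ε t q f z + b * heunLHS α β γ δ ε t q g z := by
  have h : deriv (fun w => a * f w + b * g w) =ᶠ[𝓝 z] fun w => a * deriv f w + b * deriv g w := by
    filter_upwards [hf.eventually_analyticAt, hg.eventually_analyticAt] with w hw1 hw2
    exact deriv_linear_combination hw1 hw2 a b
  simp only [heunLHS, h.deriv_eq, deriv_linear_combination hf hg,
    deriv_linear_combination hf.deriv hg.deriv]
  ring

/-- A solution of Heun's equation is determined by its value and derivative at a point. -/
theorem heun_eqOn_zero {α β γ δ ε t q : ℂ} {y : ℂ → ℂ} {U V : Set ℂ} {z : ℂ}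
    (hV : IsOpen V) (hU : IsOpen U) (hUc : IsPreconnected U) (hVU : V ⊆ U)
    (hy : DifferentiableOn ℂ y U) (hz : z ∈ V) (hz0 : z ≠ 0) (hz1 : z ≠ 1) (hzt : z ≠ t)
    (h : ∀ w ∈ V, heunLHS α β γ δ ε t q y w = 0) (h0 : y z = 0) (h1 : deriv y z = 0) :
    ∀ w ∈ U, y w = 0 := by
  have ha := hy.analyticOnNhd hU
  have hz1' := sub_ne_zero.2 hz1
  have hzt' := sub_ne_zero.2 hzt
  have hp : AnalyticAt ℂ (fun z : ℂ => γ / z + δ / (z - 1) + ε / (z - t)) z := by fun_prop (disch := assumption)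
  have hr : AnalyticAt ℂ (fun z : ℂ => (α * β * z - q) / (z * (z - 1) * (z - t))) z :=
    AnalyticAt.div (by fun_prop) (by fun_prop) (mul_ne_zero (mul_ne_zero hz0 hz1') hzt')
  exact ha.eqOn_zero_of_preconnected_of_eventuallyEq_zero hUc (hVU hz)
    (eventually_zero_of_ode (ha z (hVU hz)) hp hr (by
      filter_upwards [hV.mem_nhds hz] with w hw using h w hw) h0 h1)

theorem ne_zero_and_ne_one_of_mem_doublySlitPlane {z : ℂ} (hz : z ∈ doublySlitPlane) : z ≠ 0 ∧ z ≠ 1 := by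
  refine ⟨Complex.slitPlane_ne_zero hz.1, fun h => ?_⟩
  have := Complex.slitPlane_ne_zero hz.2
  simp [h] at this

/-- Two functions that are holomorphic on the plane cut along `[1, ∞)` and on the plane cut along
`(-∞, 0]` and agree on the doubly slit plane are restrictions of an entire function. -/
theorem exists_entire_of_eqOn {f g : ℂ → ℂ} (hf : DifferentiableOn ℂ f gaussDomain)
    (hg : DifferentiableOn ℂ g Complex.slitPlane) (h : ∀ z ∈ doublySlitPlane, f z = g z) :
    ∃ Y : ℂ → ℂ, Differentiable ℂ Y ∧ (∀ z ∈ gaussDomain, Y z = f z) ∧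
      ∀ z ∈ Complex.slitPlane, Y z = g z := by
  classical
  set Y : ℂ → ℂ := fun z => if z ∈ gaussDomain then f z else g z with hY
  have h1 : ∀ z ∈ gaussDomain, Y z = f z := fun z hz => by simp only [hY, hz, if_true]
  have h2 : ∀ z ∈ Complex.slitPlane, Y z = g z := fun z hz => by
    by_cases hz' : z ∈ gaussDomain
    · rw [h1 z hz', h z ⟨hz, hz'⟩]
    · simp only [hY, hz', if_false]
  refine ⟨Y, fun z => ?_, h1, h2⟩
  rcases gaussDomain_union_slitPlane z with hz | hz
  · exact (hf.congr h1).differentiableAt (isOpen_gaussDomain.mem_nhds hz)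
  · exact (hg.congr h2).differentiableAt (Complex.isOpen_slitPlane.mem_nhds hz)

theorem mem_hypergeometricSpan_finite {y : ℂ → ℂ} (hy : y ∈ hypergeometricSpan) :
    ∃ (n : ℕ) (c : Fin n → ℂ) (φ : Fin n → ℂ → ℂ), (∀ i, IsHypergeometricSolution (φ i) ∧
      IsHypergeometricSolution fun z => φ i (1 - z)) ∧ ∀ z, y z = ∑ i, c i * φ i z := by
  obtain ⟨n, c, φ, rfl⟩ := Submodule.mem_span_set'.1 hy
  exact ⟨n, c, fun i => φ i, fun i => (φ i).2, fun z => by simp [Finset.sum_apply]⟩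

/-! ### The basis of solutions and the conclusion -/

theorem mainTheorem8 (α β γ δ t q : ℂ) (ε : ℤ)
    (hsum : γ + δ + (ε : ℂ) = α + β + 1) (ht0 : t ≠ 0) (ht1 : t ≠ 1)
    (hε : ε ≤ 0)
    (hα : ∀ n : ℤ, α ≠ (n : ℂ)) (hβ : ∀ n : ℤ, β ≠ (n : ℂ))
    (hβγ : ∀ n : ℤ, β - γ ≠ (n : ℂ)) (hβδ : ∀ n : ℤ, β - δ ≠ (n : ℂ))
    (happ : HeunApparentAt α β γ δ ε t q) :
    ∃ (N : ℕ) (φ : Fin N → ℂ → ℂ), (∀ i, IsHypergeometricSolution (φ i)) ∧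
      ∀ (U : Set ℂ) (y : ℂ → ℂ), IsOpen U → IsPreconnected U →
        U ⊆ doublySlitPlane \ {t} → IsHeunSolutionOn α β γ δ (ε : ℂ) t q U y →
        ∃ C : Fin N → ℂ, ∀ z ∈ U, y z = ∑ i, C i * φ i z := by
  obtain ⟨f, -, hf, hft, -, -, hfs, -⟩ := happ
  obtain ⟨M, hM⟩ : ∃ M : ℕ, (ε : ℂ) = -M := by
    obtain ⟨M, hM⟩ := Int.eq_ofNat_of_zero_le (neg_nonneg.2 hε)
    exact ⟨M, by rw [← neg_neg ε, hM]; simp⟩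
  obtain ⟨y₀, hs₀, hd₀, hh₀, hn₀⟩ :=
    exists_heun_solution_of_apparent hM hsum ht0 ht1 hα hβ hf hft hfs
  obtain ⟨y₁, hs₁, hd₁, hh₁, hn₁⟩ := exists_heun_solution_of_apparent (γ := δ) (δ := γ)
    (t := 1 - t) (q := α * β - q) (f := fun z => f (1 - z)) hM (by linear_combination hsum)
    (sub_ne_zero.2 ht1.symm) (fun h => ht0 (by linear_combination -h)) hα hβ
    (AnalyticAt.fun_comp (g := f) (f := fun z : ℂ => 1 - z) (by simpa using hf) (by fun_prop))
    (by simpa using hft) (by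
      have : Tendsto (fun z : ℂ => 1 - z) (𝓝[≠] (1 - t)) (𝓝[≠] t) := by
        refine tendsto_nhdsWithin_of_tendsto_nhds_of_eventually_within _ ?_ ?_
        · have : ContinuousAt (fun z : ℂ => 1 - z) (1 - t) := by fun_prop
          refine Tendsto.mono_left ?_ nhdsWithin_le_nhds
          simpa [ContinuousAt] using this
        · filter_upwards [self_mem_nhdsWithin] with z hz h
          exact hz (by rw [← h.out]; simp)
      filter_upwards [this.eventually hfs] with z hz
      rw [heunLHS_comp_one_sub, hz])
  set x₁ : ℂ → ℂ := fun z => y₁ (1 - z) with hx₁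
  have hdx : DifferentiableOn ℂ x₁ Complex.slitPlane :=
    hd₁.comp (by fun_prop) fun z hz => one_sub_mem_gaussDomain.2 hz
  -- A relation glues multiples of `y₀` and `x₁` to an entire function, which neither admits.
  have hne : ∀ c₀ c₁ : ℂ, (∀ z ∈ doublySlitPlane, c₀ * y₀ z + c₁ * x₁ z = 0) →
      c₀ = 0 ∧ c₁ = 0 := fun c₀ c₁ h => by
    obtain ⟨Y, hY, hY0, hY1⟩ := exists_entire_of_eqOn (f := fun z => c₀ * y₀ z)
      (g := fun z => -c₁ * x₁ z) (hd₀.const_mul c₀) (hdx.const_mul _)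
      fun z hz => by linear_combination h z hz
    constructor
    · by_contra hc
      refine hn₀ (fun z => c₀⁻¹ * Y z) (hY.const_mul _) ?_
      filter_upwards [isOpen_gaussDomain.mem_nhds zero_mem_gaussDomain] with z hz
      rw [hY0 z hz]
      field_simp
    · by_contra hc
      refine hn₁ (fun z => -c₁⁻¹ * Y (1 - z)) ((hY.comp (by fun_prop)).const_mul _) ?_
      filter_upwards [isOpen_gaussDomain.mem_nhds zero_mem_gaussDomain] with z hz
      rw [hY1 (1 - z) hz, hx₁]
      field_simp
      simp
  obtain ⟨n₀, a₀, φ₀, hφ₀, hs₀⟩ := mem_hypergeometricSpan_finite hs₀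
  obtain ⟨n₁, a₁, φ₁, hφ₁, hs₁⟩ := mem_hypergeometricSpan_finite hs₁
  refine ⟨n₀ + n₁, Fin.append φ₀ fun i z => φ₁ i (1 - z), fun i => ?_, fun U y hU hUc hUs hy => ?_⟩
  · refine Fin.addCases (fun i => ?_) (fun i => ?_) i
    · rw [Fin.append_left]
      exact (hφ₀ i).1
    · rw [Fin.append_right]
      exact (hφ₁ i).2
  suffices h : ∃ c₀ c₁ : ℂ, ∀ z ∈ U, y z = c₀ * y₀ z + c₁ * x₁ z by
    obtain ⟨c₀, c₁, h⟩ := h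
    refine ⟨Fin.append (fun i => c₀ * a₀ i) fun i => c₁ * a₁ i, fun z hz => ?_⟩
    have e : x₁ z = ∑ i, a₁ i * φ₁ i (1 - z) := hs₁ (1 - z)
    rw [h z hz, Fin.sum_univ_add, hs₀, e, Finset.mul_sum, Finset.mul_sum]
    simp [mul_assoc]
  rcases U.eq_empty_or_nonempty with rfl | ⟨z, hz⟩
  · exact ⟨0, 0, fun z hz => hz.elim⟩
  have hUD : U ⊆ doublySlitPlane := fun w hw => (hUs hw).1
  have hDt : IsOpen (doublySlitPlane \ {t}) := isOpen_doublySlitPlane.sdiff isClosed_singleton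
  have hD₀ : DifferentiableOn ℂ y₀ doublySlitPlane := hd₀.mono fun w hw => hw.2
  have hD₁ : DifferentiableOn ℂ x₁ doublySlitPlane := hdx.mono fun w hw => hw.1
  have hA₀ := hD₀.analyticOnNhd isOpen_doublySlitPlane
  have hA₁ := hD₁.analyticOnNhd isOpen_doublySlitPlane
  have hne_pt : ∀ w ∈ doublySlitPlane \ {t}, w ≠ 0 ∧ w ≠ 1 ∧ w ≠ t := fun w hw =>
    have := ne_zero_and_ne_one_of_mem_doublySlitPlane hw.1
    ⟨this.1, this.2, hw.2⟩
  have hL : ∀ (u : ℂ → ℂ), ∀ w ∈ doublySlitPlane \ {t}, heunOp α β γ δ ε t q u w = 0 →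
      heunLHS α β γ δ ε t q u w = 0 := fun u w hw h => by
    obtain ⟨h0, h1, h2⟩ := hne_pt w hw
    rw [heunOp_eq_mul_heunLHS h0 h1 h2] at h
    exact (mul_eq_zero.1 h).resolve_left
      (mul_ne_zero (mul_ne_zero h0 (sub_ne_zero.2 h1)) (sub_ne_zero.2 h2))
  have hL₀ : ∀ w ∈ doublySlitPlane \ {t}, heunLHS α β γ δ ε t q y₀ w = 0 := fun w hw =>
    hL y₀ w hw (hh₀ w hw.1.2)
  have hL₁ : ∀ w ∈ doublySlitPlane \ {t}, heunLHS α β γ δ ε t q x₁ w = 0 := fun w hw =>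
    hL x₁ w hw (by
      rw [hx₁, heunOp_comp_one_sub, hh₁ _ (one_sub_mem_gaussDomain.2 hw.1.1), neg_zero])
  obtain ⟨hz0, hz1, hzt⟩ := hne_pt z (hUs hz)
  have hz₀ := hA₀ z (hUD hz)
  have hz₁ := hA₁ z (hUD hz)
  have hcomb : ∀ c₀ c₁ : ℂ, c₀ * y₀ z + c₁ * x₁ z = 0 → c₀ * deriv y₀ z + c₁ * deriv x₁ z = 0 →
      c₀ = 0 ∧ c₁ = 0 := fun c₀ c₁ h1 h2 => by
    -- The equation is used only off `t`, but the identity theorem runs on the whole doubly slit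
    -- plane, where both solutions are holomorphic even at `t`.
    refine hne c₀ c₁ (heun_eqOn_zero (α := α) (β := β) (γ := γ) (δ := δ) (ε := ε) (t := t)
      (q := q) hDt isOpen_doublySlitPlane isPreconnected_doublySlitPlane Set.sdiff_subset
      ((hD₀.const_mul c₀).add (hD₁.const_mul c₁)) (hUs hz) hz0 hz1 hzt (fun w hw => ?_) h1 ?_)
    · refine (heunLHS_linear_combination _ _ _ _ _ _ _ (hA₀ w hw.1) (hA₁ w hw.1) _ _).trans ?_
      rw [hL₀ w hw, hL₁ w hw]
      ring
    · exact (deriv_linear_combination hz₀ hz₁ _ _).trans h2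
  -- If the Wronskian vanished, `(x₁, -y₀)` and `(x₁', -y₀')` would be trivial relations, so all
  -- Cauchy data would be zero and `(1, 0)` would be a relation too.
  have hW : y₀ z * deriv x₁ z - x₁ z * deriv y₀ z ≠ 0 := fun hW => by
    obtain ⟨h1, h2⟩ := hcomb (x₁ z) (-y₀ z) (by ring) (by linear_combination -hW)
    obtain ⟨h3, h4⟩ := hcomb (deriv x₁ z) (-deriv y₀ z)
      (by linear_combination deriv y₀ z * -h1 - deriv x₁ z * h2) (by ring)
    exact one_ne_zero (hcomb 1 0 (by linear_combination -h2) (by linear_combination -h4)).1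
  obtain ⟨c₀, c₁, hc, hc'⟩ : ∃ c₀ c₁ : ℂ, c₀ * y₀ z + c₁ * x₁ z = y z ∧
      -- The witnesses are given by Cramer's rule.
      c₀ * deriv y₀ z + c₁ * deriv x₁ z = deriv y z :=
    ⟨(y z * deriv x₁ z - x₁ z * deriv y z) / (y₀ z * deriv x₁ z - x₁ z * deriv y₀ z),
      (y₀ z * deriv y z - y z * deriv y₀ z) / (y₀ z * deriv x₁ z - x₁ z * deriv y₀ z),
      by
        rw [div_mul_eq_mul_div, div_mul_eq_mul_div, ← add_div, div_eq_iff hW]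
        ring,
      by
        rw [div_mul_eq_mul_div, div_mul_eq_mul_div, ← add_div, div_eq_iff hW]
        ring⟩
  refine ⟨c₀, c₁, fun w hw => ?_⟩
  have hyA := hy.1.analyticOnNhd hU
  have hcA : ∀ w ∈ U, AnalyticAt ℂ (fun w => c₀ * y₀ w + c₁ * x₁ w) w := fun w hw =>
    (analyticAt_const.mul (hA₀ w (hUD hw))).add (analyticAt_const.mul (hA₁ w (hUD hw)))
  have := heun_eqOn_zero (α := α) (β := β) (γ := γ) (δ := δ) (ε := ε) (t := t) (q := q)
    (y := fun w => 1 * y w + -1 * (c₀ * y₀ w + c₁ * x₁ w)) hU hU hUc subset_rfl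
    (fun w hw => ((analyticAt_const.mul (hyA w hw)).add
      (analyticAt_const.mul (hcA w hw))).differentiableAt.differentiableWithinAt)
    hz hz0 hz1 hzt (fun w hw => ?_) ?_ ?_ w hw
  · linear_combination this
  · rw [heunLHS_linear_combination _ _ _ _ _ _ _ (hyA w hw) (hcA w hw),
      heunLHS_linear_combination _ _ _ _ _ _ _ (hA₀ w (hUD hw)) (hA₁ w (hUD hw)), hy.2 w hw,
      hL₀ w (hUs hw), hL₁ w (hUs hw)]
    ring
  · linear_combination -hc
  · rw [deriv_linear_combination (hyA z hz) (hcA z hz), deriv_linear_combination hz₀ hz₁]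
    linear_combination -hc'
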